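/- Let $k\ge 2$ be an integer. Let $$\Lambda_k=\Bigl\{(b_1^{k+1}b_2^{k+2}\cdots b_{k-1}^{2k-1})^{1/k}\ :\ b_1,\dots,b_{k-1}\in\mathbb Z_{\ge1},\ b_1\cdots b_{k-1}\ge 2,\ b_1\cdots b_{k-1}\text{ squarefree}\Bigr\},$$ and for $\mathcal I\subseteq\Lambda_k$ let $\mathcal S_{\mathcal I}=\{a^k\lambda^k : a\in\mathbb Z_{\ge1},\ \lambda\in\mathcal I\}$ (so $\mathcal S_\varnothing=\varnothing$, and $\mathcal S_{\Lambda_k}$ is the set of all $k$-full integers that are not perfect $k$th powers). Let $\mathcal I,\mathcal J$ be finite subsets of $\Lambda_k$ with $\mathcal I\cap\mathcal J=\varnothing$, and let $\mathcal B^{(k)}_{\mathcal I,\mathcal J}$ be the set of all integers $n\ge1$ such that $$\#\bigl((n^k,(n+1)^k)\cap\mathcal S_{\mathcal I}\bigr)=\#\mathcal I,\qquad \#\bigl(((n+1)^k,(n+2)^k)\cap\mathcal S_{\mathcal J}\bigr)=\#\mathcal J,\qquad (n^k,(n+2)^k)\cap\mathcal S_{\Lambda_k\setminus(\mathcal I\cup\mathcal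 J)}=\varnothing .$$ Then the product $\prod_{\lambda\in\Lambda_k\setminus(\mathcal I\cup\mathcal J)}(1-2/\lambda)$ converges unconditionally, and $\mathcal B^{(k)}_{\mathcal I,\mathcal J}$ has positive asymptotic density $$\lim_{x\to\infty}\frac{\#\{n\in\mathcal B^{(k)}_{\mathcal I,\mathcal J} : n\le x\}}{x}=\prod_{\lambda\in\mathcal I\cup\mathcal J}\frac1\lambda\cdot\prod_{\lambda\in\Lambda_k\setminus(\mathcal I\cup\mathcal J)}\Bigl(1-\frac2\lambda\Bigr)>0 .$$ -/

import Mathlib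

open Filter Topology

noncomputable section

namespace KFull

/-- The set `Λ_k` of the real numbers `(b₁^(k+1) ⋯ b_{k-1}^(2k-1))^(1/k)`, where `b₁, …, b_{k-1}` are
positive integers whose product is squarefree and at least `2`
(`b j` for `j : Fin (k - 1)` is `b_{j+1}`, which carries the exponent `k + (j + 1)`). -/
def Lam (k : ℕ) : Set ℝ :=
  {l : ℝ | ∃ b : Fin (k - 1) → ℕ,
    (∀ j, 1 ≤ b j) ∧ 2 ≤ ∏ j, b j ∧ Squarefree (∏ j, b j) ∧
      l = ((∏ j, b j ^ (k + (j.val + 1)) : ℕ) : ℝ) ^ ((1 : ℝ) / (k : ℝ))}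

/-- The set `S_I = {a^k λ^k : a ≥ 1, λ ∈ I}`, as a set of real numbers. -/
def S (k : ℕ) (I : Set ℝ) : Set ℝ :=
  {x : ℝ | ∃ a : ℕ, 1 ≤ a ∧ ∃ l ∈ I, x = (a : ℝ) ^ k * l ^ k}

/-- The set of the positive integers `n` such that `(n^k, (n+1)^k)` contains exactly `#I` elements of
`S_I`, `((n+1)^k, (n+2)^k)` contains exactly `#J` elements of `S_J`, and `(n^k, (n+2)^k)` is disjoint
from `S_{Λ_k ∖ (I ∪ J)}`. -/
def B (k : ℕ) (I J : Finset ℝ) : Set ℕ :=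
  {n : ℕ | 1 ≤ n ∧
    (Set.Ioo ((n : ℝ) ^ k) (((n : ℝ) + 1) ^ k) ∩ S k (I : Set ℝ)).encard = (I.card : ℕ∞) ∧
    (Set.Ioo (((n : ℝ) + 1) ^ k) (((n : ℝ) + 2) ^ k) ∩ S k (J : Set ℝ)).encard = (J.card : ℕ∞) ∧
    Set.Ioo ((n : ℝ) ^ k) (((n : ℝ) + 2) ^ k) ∩ S k (Lam k \ ((I : Set ℝ) ∪ (J : Set ℝ))) = ∅}

/-- The set `A` has asymptotic density `d`: `#{n ∈ A : n ≤ x} / x → d` as the real `x → ∞`. -/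
def HasAsymptoticDensity (A : Set ℕ) (d : ℝ) : Prop :=
  Tendsto (fun x : ℝ => (Set.ncard {n : ℕ | n ∈ A ∧ (n : ℝ) ≤ x} : ℝ) / x) atTop (𝓝 d)

/-- The number `∏_{λ ∈ I ∪ J} 1/λ · ∏_{λ ∈ Λ_k ∖ (I ∪ J)} (1 - 2/λ)`. -/
def dens (k : ℕ) (I J : Finset ℝ) : ℝ :=
  (∏ l ∈ I ∪ J, 1 / l) *
    ∏' l : ↥(Lam k \ ((I : Set ℝ) ∪ (J : Set ℝ))), (1 - 2 / (l : ℝ))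

end KFull

end

namespace KFull

/-! ### Linear independence of real radicals -/

/-- A positive real radical whose `k`-th power is rational has a rational `d`-th power, where `d` is
its degree over `ℚ`. -/
theorem exists_rat_eq_pow_natDegree {k : ℕ} (hk : k ≠ 0) {x : ℝ} (hx : 0 < x) {q : ℚ}
    (hq : x ^ k = q) : ∃ r : ℚ, x ^ (minpoly ℚ x).natDegree = r := by
  have hint : IsIntegral ℚ x := by
    refine IsIntegral.of_pow (Nat.pos_of_ne_zero hk) ?_
    rw [hq]
    exact isIntegral_algebraMap (R := ℚ) (A := ℝ) (x := q)
  have hgen : IntermediateField.AdjoinSimple.gen ℚ x ^ k = algebraMap ℚ _ q := by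
    apply Subtype.ext
    simpa using hq
  have hnorm := congrArg (Algebra.norm ℚ) hgen
  rw [map_pow, Algebra.norm_algebraMap, IntermediateField.adjoin.finrank hint] at hnorm
  refine ⟨|Algebra.norm ℚ (IntermediateField.AdjoinSimple.gen ℚ x)|, ?_⟩
  rw [← pow_left_inj₀ (by positivity) (by positivity) hk, ← pow_mul, mul_comm, pow_mul, hq]
  have hq0 : 0 < (q : ℝ) := hq ▸ pow_pos hx k
  have h2 := congrArg (fun t : ℚ => ((|t| : ℚ) : ℝ)) hnorm
  simp only [abs_pow] at h2
  push_cast at h2 ⊢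
  rw [h2, abs_of_pos hq0]

/-- The minimal polynomial of an irrational positive real radical has vanishing next coefficient. -/
theorem nextCoeff_minpoly_radical {k : ℕ} (hk : k ≠ 0) {x : ℝ} (hx : 0 < x) {q : ℚ}
    (hq : x ^ k = q) (hirr : Irrational x) : (minpoly ℚ x).nextCoeff = 0 := by
  have hint : IsIntegral ℚ x := by
    refine IsIntegral.of_pow (Nat.pos_of_ne_zero hk) ?_
    rw [hq]
    exact isIntegral_algebraMap (R := ℚ) (A := ℝ) (x := q)
  obtain ⟨r, hr⟩ := exists_rat_eq_pow_natDegree hk hx hq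
  set d := (minpoly ℚ x).natDegree with hd
  have hd2 : 2 ≤ d := by
    rw [hd, minpoly.two_le_natDegree_iff hint]
    rintro ⟨y, hy⟩
    exact hirr ⟨y, by simpa using hy⟩
  have hmin : minpoly ℚ x = Polynomial.X ^ d - Polynomial.C r := by
    symm
    have hd0 : d ≠ 0 := by omega
    refine minpoly.unique_of_degree_le_degree_minpoly ℚ x (Polynomial.monic_X_pow_sub_C r hd0) ?_ ?_
    · simp [hr]
    · rw [Polynomial.degree_X_pow_sub_C (by omega), hd,
        Polynomial.degree_eq_natDegree (minpoly.ne_zero hint)]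
  rw [hmin, Polynomial.nextCoeff_of_natDegree_pos (by rw [Polynomial.natDegree_X_pow_sub_C]; omega),
    Polynomial.natDegree_X_pow_sub_C, Polynomial.coeff_sub, Polynomial.coeff_X_pow,
    Polynomial.coeff_C, if_neg (by omega), if_neg (by omega), sub_zero]

/-- Positive real radicals with pairwise irrational ratios are linearly independent over `ℚ`. -/
theorem linearIndependent_radicals {ι : Type*} [Finite ι] {k : ℕ} (hk : k ≠ 0) (α : ι → ℝ)
    (hpos : ∀ i, 0 < α i) (hpow : ∀ i, ∃ q : ℚ, α i ^ k = q)
    (hirr : ∀ i j, i ≠ j → Irrational (α i / α j)) :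
    LinearIndependent ℚ α := by
  classical
  have := Fintype.ofFinite ι
  rw [Fintype.linearIndependent_iff]
  intro c hc j
  let K := IntermediateField.adjoin ℚ (Set.range α)
  have : FiniteDimensional ℚ K := by
    apply IntermediateField.finiteDimensional_adjoin
    rintro _ ⟨i, rfl⟩
    obtain ⟨q, hq⟩ := hpow i
    refine IsIntegral.of_pow (Nat.pos_of_ne_zero hk) ?_
    rw [hq]
    exact isIntegral_algebraMap (R := ℚ) (A := ℝ) (x := q)
  let β : ι → K := fun i => ⟨α i, IntermediateField.subset_adjoin _ _ ⟨i, rfl⟩⟩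
  have hsum : ∑ i, c i • (β i / β j) = 0 := by
    apply Subtype.ext
    have : ∑ i, c i • (α i / α j) = 0 := by
      simp only [← smul_div_assoc, ← Finset.sum_div, hc, zero_div]
    simpa [β] using this
  have htr := congrArg (Algebra.trace ℚ K) hsum
  rw [map_sum, map_zero, Finset.sum_eq_single j, map_smul] at htr
  · have hb : β j ≠ 0 := by
      intro h
      exact (hpos j).ne' (congrArg Subtype.val h)
    rw [div_self hb, ← map_one (algebraMap ℚ K), Algebra.trace_algebraMap] at htr
    simpa [Module.finrank_pos.ne'] using htr
  · intro i _ hij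
    rw [map_smul, trace_eq_finrank_mul_minpoly_nextCoeff]
    have hm : minpoly ℚ (β i / β j) = minpoly ℚ (α i / α j) := by
      rw [← minpoly.algebraMap_eq (algebraMap K ℝ).injective]
      rfl
    obtain ⟨q, hq⟩ := hpow i
    obtain ⟨q', hq'⟩ := hpow j
    rw [hm, nextCoeff_minpoly_radical hk (div_pos (hpos i) (hpos j)) (q := q / q')
      (by rw [div_pow, hq, hq']; push_cast; rfl) (hirr i j hij)]
    simp
  · simp

/-! ### Arithmetic of `Λ_k` -/

/-- The exponents in the factorization of `N` are `0` or lie strictly between `k` and `2k`. -/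
def IsPrimitiveKFull (k N : ℕ) : Prop :=
  N ≠ 0 ∧ ∀ p, N.factorization p = 0 ∨ k < N.factorization p ∧ N.factorization p < 2 * k

theorem isPrimitiveKFull_one (k : ℕ) : IsPrimitiveKFull k 1 := by
  simp [IsPrimitiveKFull]

theorem IsPrimitiveKFull.eq_of_pow_mul_eq {k N M a b : ℕ} (hN : IsPrimitiveKFull k N)
    (hM : IsPrimitiveKFull k M) (ha : a ≠ 0) (hb : b ≠ 0) (h : a ^ k * N = b ^ k * M) : N = M := by
  refine Nat.eq_of_factorization_eq hN.1 hM.1 fun p => ?_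
  have h1 := congrArg (fun t => t.factorization p % k) h
  simp only [Nat.factorization_mul (pow_ne_zero k ha) hN.1,
    Nat.factorization_mul (pow_ne_zero k hb) hM.1, Nat.factorization_pow, Finsupp.add_apply,
    Finsupp.smul_apply, smul_eq_mul, Nat.mul_add_mod] at h1
  have key : ∀ v, k < v ∧ v < 2 * k → v % k = v - k := fun v hv => by
    rw [Nat.mod_eq_sub_mod hv.1.le, Nat.mod_eq_of_lt (by omega)]
  rcases hN.2 p with hn | hn <;> rcases hM.2 p with hm | hm
  · rw [hn, hm]
  · rw [hn, key _ hm, Nat.zero_mod] at h1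
    omega
  · rw [hm, key _ hn, Nat.zero_mod] at h1
    omega
  · rw [key _ hn, key _ hm] at h1
    omega

theorem isPrimitiveKFull_prod {k : ℕ} {b : Fin (k - 1) → ℕ} (hb : ∀ j, 1 ≤ b j)
    (hsq : Squarefree (∏ j, b j)) : IsPrimitiveKFull k (∏ j, b j ^ (k + (j.val + 1))) := by
  have hb0 : ∀ j, b j ≠ 0 := fun j => Nat.one_le_iff_ne_zero.1 (hb j)
  refine ⟨Finset.prod_ne_zero_iff.2 fun j _ => pow_ne_zero _ (hb0 j), fun p => ?_⟩
  have h1 := hsq.natFactorization_le_one p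
  rw [Nat.factorization_prod fun j _ => hb0 j] at h1
  rw [Nat.factorization_prod fun j _ => pow_ne_zero _ (hb0 j)]
  simp only [Finsupp.coe_finsetSum, Finset.sum_apply, Nat.factorization_pow, Finsupp.smul_apply,
    smul_eq_mul] at h1 ⊢
  by_cases h : ∀ j, (b j).factorization p = 0
  · left
    simp [h]
  · right
    push Not at h
    obtain ⟨j, hj⟩ := h
    have hz : ∀ i, i ≠ j → (b i).factorization p = 0 := by
      intro i hij
      have := Finset.add_le_sum (f := fun i => (b i).factorization p) (fun _ _ => Nat.zero_le _)
        (Finset.mem_univ i) (Finset.mem_univ j) hij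
      omega
    have h1j := Finset.single_le_sum (f := fun i => (b i).factorization p)
      (fun _ _ => Nat.zero_le _) (Finset.mem_univ j)
    rw [Finset.sum_eq_single j (fun i _ hij => by rw [hz i hij, mul_zero]) (by simp)]
    have : (b j).factorization p = 1 := by omega
    have := j.isLt
    rw [‹(b j).factorization p = 1›]
    omega

theorem exists_pow_eq_of_mem_Lam {k : ℕ} (hk : 2 ≤ k) {l : ℝ} (hl : l ∈ Lam k) :
    2 < l ∧ ∃ N : ℕ, N ≠ 1 ∧ IsPrimitiveKFull k N ∧ l ^ k = N := by
  obtain ⟨b, hb, h2, hsq, rfl⟩ := hl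
  set N := ∏ j, b j ^ (k + (j.val + 1)) with hN
  have hlt : 2 ^ (k + 1) ≤ N := by
    calc 2 ^ (k + 1) ≤ (∏ j, b j) ^ (k + 1) := Nat.pow_le_pow_left h2 _
      _ = ∏ j, b j ^ (k + 1) := (Finset.prod_pow _ _ _).symm
      _ ≤ N := Finset.prod_le_prod' fun j _ => Nat.pow_le_pow_right (hb j) (by omega)
  have hpow : ((N : ℝ) ^ ((1 : ℝ) / k)) ^ k = N := by
    rw [one_div, Real.rpow_inv_natCast_pow (Nat.cast_nonneg _) (by omega)]
  refine ⟨?_, N, ?_, isPrimitiveKFull_prod hb hsq, hpow⟩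
  · refine lt_of_pow_lt_pow_left₀ k (by positivity) ?_
    rw [hpow]
    have : 2 ^ k < N := lt_of_lt_of_le (Nat.pow_lt_pow_right (by norm_num) (by omega)) hlt
    exact_mod_cast this
  · have : 1 < 2 ^ (k + 1) := Nat.one_lt_two_pow (by omega)
    omega

theorem two_lt_of_mem_Lam {k : ℕ} (hk : 2 ≤ k) {l : ℝ} (hl : l ∈ Lam k) : 2 < l :=
  (exists_pow_eq_of_mem_Lam hk hl).1

theorem eq_of_nat_mul_eq {k : ℕ} {x y : ℝ} {N M : ℕ} (hN : IsPrimitiveKFull k N)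
    (hM : IsPrimitiveKFull k M) (hx : x ^ k = N) (hy : y ^ k = M) {a b : ℕ} (ha : a ≠ 0)
    (hb : b ≠ 0) (h : a * x = b * y) : N = M := by
  refine hN.eq_of_pow_mul_eq hM ha hb ?_
  have := congrArg (· ^ k) h
  simp only [mul_pow, hx, hy] at this
  exact_mod_cast this

theorem irrational_div_of_ne {k : ℕ} {x y : ℝ} {N M : ℕ} (hx0 : 0 < x) (hy0 : 0 < y)
    (hN : IsPrimitiveKFull k N) (hM : IsPrimitiveKFull k M) (hx : x ^ k = N) (hy : y ^ k = M)
    (hne : N ≠ M) : Irrational (x / y) := by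
  rintro ⟨q, hq⟩
  have hqpos : 0 < q := by
    have : (0 : ℝ) < q := hq ▸ div_pos hx0 hy0
    exact_mod_cast this
  refine hne (eq_of_nat_mul_eq hN hM hx hy (a := q.den) (b := q.num.toNat) q.den_nz ?_ ?_)
  · have := Rat.num_pos.2 hqpos
    omega
  · have hnum : ((q.num.toNat : ℕ) : ℝ) = (q.num : ℝ) := by
      have := Int.toNat_of_nonneg (Rat.num_pos.2 hqpos).le
      exact_mod_cast this
    have hden : (q.den : ℝ) ≠ 0 := by exact_mod_cast q.den_nz
    rw [Rat.cast_def, div_eq_div_iff hden hy0.ne'] at hq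
    rw [hnum, hq, mul_comm]

theorem eq_of_pow_eq_pow {k : ℕ} (hk : 2 ≤ k) {x y : ℝ} (hx : x ∈ Lam k) (hy : y ∈ Lam k)
    (h : x ^ k = y ^ k) : x = y := by
  have hx2 := two_lt_of_mem_Lam hk hx
  have hy2 := two_lt_of_mem_Lam hk hy
  exact (pow_left_inj₀ (by linarith) (by linarith) (by omega)).1 h

theorem eq_of_mul_eq_mul {k : ℕ} (hk : 2 ≤ k) {x y : ℝ} (hx : x ∈ Lam k) (hy : y ∈ Lam k)
    {a b : ℕ} (ha : 1 ≤ a) (hb : 1 ≤ b) (h : a * x = b * y) : x = y := by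
  obtain ⟨-, N, -, hN, hxN⟩ := exists_pow_eq_of_mem_Lam hk hx
  obtain ⟨-, M, -, hM, hyM⟩ := exists_pow_eq_of_mem_Lam hk hy
  refine eq_of_pow_eq_pow hk hx hy ?_
  rw [hxN, hyM, eq_of_nat_mul_eq hN hM hxN hyM (by omega) (by omega) h]

/-- The reciprocals of distinct elements of `Λ_k` have no nontrivial integral combination that is an
integer. -/
theorem sum_inv_ne_int {k : ℕ} (hk : 2 ≤ k) {F : Finset ℝ} (hF : (F : Set ℝ) ⊆ Lam k)
    {m : F → ℤ} (hm : m ≠ 0) (z : ℤ) : ∑ l : F, (m l : ℝ) * (l : ℝ)⁻¹ ≠ z := by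
  intro hz
  have hli : LinearIndependent ℚ (fun o : Option F => o.elim (1 : ℝ) fun l => (l : ℝ)⁻¹) := by
    have hdat : ∀ o : Option F, ∃ N : ℕ, IsPrimitiveKFull k N ∧
        0 < o.elim (1 : ℝ) (fun l => (l : ℝ)) ∧ (o.elim (1 : ℝ) fun l => (l : ℝ)) ^ k = N := by
      rintro (_ | l)
      · exact ⟨1, isPrimitiveKFull_one k, by simp, by simp⟩
      · obtain ⟨h2, N, -, hN, hN'⟩ := exists_pow_eq_of_mem_Lam hk (hF l.2)
        exact ⟨N, hN, by simp; linarith, hN'⟩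
    choose N hN hpos hpow using hdat
    have hinv : ∀ o : Option F, (o.elim (1 : ℝ) fun l => (l : ℝ)⁻¹) =
        (o.elim (1 : ℝ) fun l => (l : ℝ))⁻¹ := by
      rintro (_ | l) <;> simp
    simp only [hinv]
    have hinj : Function.Injective N := by
      intro o o' hoo
      have h1 : (o.elim (1 : ℝ) fun l => (l : ℝ)) = o'.elim (1 : ℝ) fun l => (l : ℝ) :=
        (pow_left_inj₀ (hpos o).le (hpos o').le (n := k) (by omega)).1 (by rw [hpow, hpow, hoo])
      rcases o with _ | l <;> rcases o' with _ | l'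
      · rfl
      · have := two_lt_of_mem_Lam hk (hF l'.2)
        simp at h1
        linarith
      · have := two_lt_of_mem_Lam hk (hF l.2)
        simp at h1
        linarith
      · exact congrArg some (Subtype.ext h1)
    refine linearIndependent_radicals (k := k) (by omega) _ (fun o => inv_pos.2 (hpos o))
      (fun o => ⟨(N o : ℚ)⁻¹, by rw [inv_pow, hpow]; push_cast; rfl⟩) fun o o' hoo => ?_
    rw [inv_div_inv]
    exact irrational_div_of_ne (hpos _) (hpos _) (hN _) (hN _) (hpow _) (hpow _)
      (hinj.ne hoo.symm)
  rw [Fintype.linearIndependent_iff] at hli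
  refine hm (funext fun l => ?_)
  have := hli (fun o => o.elim (-(z : ℚ)) fun l => (m l : ℚ)) (by
    simp only [Fintype.sum_option, Option.elim, Rat.smul_def]
    push_cast
    rw [hz]
    ring) (some l)
  simpa using this

theorem summable_prod_pi {ι κ : Type*} [Fintype ι] {f : ι → κ → ℝ} (hf0 : ∀ i n, 0 ≤ f i n)
    (hf : ∀ i, Summable (f i)) : Summable fun b : ι → κ => ∏ i, f i (b i) := by
  classical
  refine summable_of_sum_le (c := ∏ i, ∑' n, f i n)
    (fun b => Finset.prod_nonneg fun i _ => hf0 i _) fun u => ?_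
  calc ∑ b ∈ u, ∏ i, f i (b i)
      ≤ ∑ b ∈ Fintype.piFinset fun i => u.image fun b => b i, ∏ i, f i (b i) := by
        refine Finset.sum_le_sum_of_subset_of_nonneg (fun b hb => ?_)
          fun b _ _ => Finset.prod_nonneg fun i _ => hf0 i _
        exact Fintype.mem_piFinset.2 fun i => Finset.mem_image_of_mem _ hb
    _ = ∏ i, ∑ n ∈ u.image (fun b => b i), f i n := (Finset.prod_univ_sum _ _).symm
    _ ≤ ∏ i, ∑' n, f i n := Finset.prod_le_prod
        (fun i _ => Finset.sum_nonneg fun n _ => hf0 i n)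
        fun i _ => (hf i).sum_le_tsum _ fun n _ => hf0 i n

theorem summable_inv_Lam {k : ℕ} (hk : 2 ≤ k) : Summable fun l : Lam k => (l : ℝ)⁻¹ := by
  have hk0 : (0 : ℝ) < k := by positivity
  have hsum : Summable fun b : Fin (k - 1) → ℕ =>
      ∏ j, ((b j : ℝ) ^ (1 + ((j : ℝ) + 1) / k))⁻¹ := by
    refine summable_prod_pi (f := fun (j : Fin (k - 1)) (n : ℕ) =>
      ((n : ℝ) ^ (1 + ((j : ℝ) + 1) / k))⁻¹) (fun j n => by positivity) fun j => ?_
    rw [Real.summable_nat_rpow_inv]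
    have : 0 < ((j : ℝ) + 1) / k := by positivity
    linarith
  choose b hb using fun l : Lam k => l.2
  have hform : ∀ l : Lam k, (l : ℝ)⁻¹ = ∏ j, ((b l j : ℝ) ^ (1 + ((j : ℝ) + 1) / k))⁻¹ := by
    intro l
    rw [(hb l).2.2.2, Finset.prod_inv_distrib]
    push_cast
    rw [← Real.finsetProd_rpow _ _ fun _ _ => by positivity]
    congr 1
    refine Finset.prod_congr rfl fun j _ => ?_
    rw [← Real.rpow_natCast, ← Real.rpow_mul (by positivity)]
    congr 1
    push_cast
    field_simp
  have hinj : Function.Injective b := by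
    intro l l' h
    apply Subtype.ext
    rw [(hb l).2.2.2, (hb l').2.2.2, h]
  exact (hsum.comp_injective hinj).congr fun l => (hform l).symm

open MeasureTheory

/-! ### Equidistribution on the torus -/

theorem tendsto_average_pow_of_ne_one {w : ℂ} (hw : ‖w‖ = 1) (hw1 : w ≠ 1) :
    Tendsto (fun N : ℕ => (N : ℂ)⁻¹ * ∑ n ∈ Finset.range N, w ^ n) atTop (𝓝 0) := by
  have hb : ∀ N : ℕ, ‖∑ n ∈ Finset.range N, w ^ n‖ ≤ 2 / ‖w - 1‖ := by
    intro N
    rw [geom_sum_eq hw1, norm_div]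
    gcongr
    calc ‖w ^ N - 1‖ ≤ ‖w ^ N‖ + ‖(1 : ℂ)‖ := norm_sub_le _ _
      _ = 2 := by rw [norm_pow, hw]; norm_num
  refine (tendsto_inv_atTop_nhds_zero_nat (𝕜 := ℂ)).zero_mul_isBoundedUnder_le ?_
  exact isBoundedUnder_of ⟨_, hb⟩

instance : IsProbabilityMeasure (volume : Measure UnitAddCircle) := ⟨by simp⟩

theorem integral_fourier_eq_zero {n : ℤ} (hn : n ≠ 0) : ∫ x : UnitAddCircle, fourier n x = 0 :=
  integral_eq_zero_of_add_right_eq_neg (fourier_add_half_inv_index hn one_pos)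

/-- The empirical measure of the first `N + 1` points of a sequence. -/
noncomputable def empirical {X : Type*} [MeasurableSpace X] (u : ℕ → X) (N : ℕ) : Measure X :=
  ((N : ENNReal) + 1)⁻¹ • ∑ n ∈ Finset.range (N + 1), Measure.dirac (u n)

instance {X : Type*} [MeasurableSpace X] (u : ℕ → X) (N : ℕ) :
    IsProbabilityMeasure (empirical u N) := ⟨by
  simp only [empirical, Measure.smul_apply, Measure.finsetSum_apply, measure_univ, smul_eq_mul,
    Finset.sum_const, Finset.card_range, nsmul_eq_mul, mul_one]
  push_cast
  exact ENNReal.inv_mul_cancel (by simp) (by finiteness)⟩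

theorem integral_empirical {X : Type*} [TopologicalSpace X] [MeasurableSpace X] [BorelSpace X]
    [CompactSpace X] [T2Space X] (u : ℕ → X) (N : ℕ) (f : C(X, ℂ)) :
    ∫ x, f x ∂(empirical u N) = ((N + 1 : ℕ) : ℂ)⁻¹ * ∑ n ∈ Finset.range (N + 1), f (u n) := by
  rw [empirical, integral_smul_measure, integral_finsetSum_measure]
  · simp only [integral_dirac]
    rw [ENNReal.toReal_inv, ENNReal.toReal_add (by finiteness) (by finiteness)]
    simp [Complex.real_smul]
  · exact fun n _ => f.continuous.integrable_of_hasCompactSupport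
      (HasCompactSupport.of_compactSpace _)

variable {ι : Type*} [Fintype ι]

theorem integral_mFourier_eq_zero {m : ι → ℤ} (hm : m ≠ 0) :
    ∫ x, UnitAddTorus.mFourier m x = 0 := by
  obtain ⟨i, hi⟩ := Function.ne_iff.1 hm
  have := integral_fintype_prod_volume_eq_prod (𝕜 := ℂ)
    (fun (i : ι) (x : UnitAddCircle) => (fourier (m i) x : ℂ))
  refine this.trans ?_
  exact Finset.prod_eq_zero (Finset.mem_univ i) (integral_fourier_eq_zero hi)

theorem mFourier_nsmul_coe (m : ι → ℤ) (θ : ι → ℝ) (n : ℕ) :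
    UnitAddTorus.mFourier m (fun i => ((n * θ i : ℝ) : UnitAddCircle)) =
      Complex.exp (2 * Real.pi * Complex.I * (∑ i, (m i : ℝ) * θ i : ℝ)) ^ n := by
  simp only [UnitAddTorus.mFourier, ContinuousMap.coe_mk, fourier_coe_apply]
  rw [← Complex.exp_sum, ← Complex.exp_nat_mul]
  congr 1
  push_cast
  rw [Finset.mul_sum, Finset.mul_sum]
  refine Finset.sum_congr rfl fun i _ => ?_
  ring

theorem tendsto_empirical_torus {θ : ι → ℝ}
    (hθ : ∀ m : ι → ℤ, m ≠ 0 → ∀ z : ℤ, ∑ i, (m i : ℝ) * θ i ≠ z) (f : C(UnitAddTorus ι, ℂ)) :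
    Tendsto (fun N => ∫ x, f x ∂(empirical (fun n i => ((n * θ i : ℝ) : UnitAddCircle)) N)) atTop
      (𝓝 (∫ x, f x)) := by
  set u : ℕ → UnitAddTorus ι := fun n i => ((n * θ i : ℝ) : UnitAddCircle) with hu
  have hint : ∀ (μ : Measure (UnitAddTorus ι)) [IsFiniteMeasure μ] (g : C(UnitAddTorus ι, ℂ)),
      Integrable g μ := fun μ _ g => g.continuous.integrable_of_hasCompactSupport
        (HasCompactSupport.of_compactSpace _)
  have hspan : ∀ g ∈ Submodule.span ℂ (Set.range (UnitAddTorus.mFourier (d := ι))),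
      Tendsto (fun N => ∫ x, g x ∂(empirical u N)) atTop (𝓝 (∫ x, g x)) := by
    intro g hg
    induction hg using Submodule.span_induction with
    | mem g hg =>
      obtain ⟨m, rfl⟩ := hg
      by_cases hm : m = 0
      · subst hm
        simp [UnitAddTorus.mFourier_zero]
      · rw [integral_mFourier_eq_zero hm]
        simp only [integral_empirical, hu, mFourier_nsmul_coe]
        refine (tendsto_average_pow_of_ne_one ?_ ?_).comp (tendsto_add_atTop_nat 1)
        · rw [Complex.norm_exp]
          simp
        · rw [Ne, Complex.exp_eq_one_iff]
          rintro ⟨z, hz⟩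
          refine hθ m hm z ?_
          have h2 : (2 * Real.pi * Complex.I : ℂ) ≠ 0 := Complex.two_pi_I_ne_zero
          rw [mul_comm] at hz
          exact_mod_cast mul_right_cancel₀ h2 hz
    | zero => simp
    | add g h _ _ ihg ihh =>
      simpa [integral_add (hint _ g) (hint _ h)] using ihg.add ihh
    | smul c g _ ih =>
      simpa [integral_const_mul] using ih.const_mul c
  have hdense : f ∈ closure (Submodule.span ℂ (Set.range (UnitAddTorus.mFourier (d := ι))) :
      Set C(UnitAddTorus ι, ℂ)) := by
    have := UnitAddTorus.span_mFourier_closure_eq_top (d := ι)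
    rw [← Submodule.topologicalClosure_coe, this]
    trivial
  rw [Metric.tendsto_atTop]
  intro ε hε
  obtain ⟨g, hg, hfg⟩ := Metric.mem_closure_iff.1 hdense (ε / 3) (by positivity)
  obtain ⟨N₀, hN₀⟩ := Metric.tendsto_atTop.1 (hspan g hg) (ε / 3) (by positivity)
  have hclose : ∀ (μ : Measure (UnitAddTorus ι)) [IsProbabilityMeasure μ],
      dist (∫ x, f x ∂μ) (∫ x, g x ∂μ) ≤ ε / 3 := by
    intro μ _
    rw [dist_eq_norm, ← integral_sub (hint μ f) (hint μ g)]
    have := norm_integral_le_of_norm_le_const (μ := μ) (f := fun x => f x - g x) (C := ε / 3)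
      (Eventually.of_forall fun x => by
        rw [← dist_eq_norm]
        exact (ContinuousMap.dist_apply_le_dist x).trans hfg.le)
    simpa using this
  refine ⟨N₀, fun N hN => ?_⟩
  have h1 := hclose (empirical u N)
  have h2 := hclose volume
  rw [dist_comm] at h2
  have h3 := hN₀ N hN
  have := dist_triangle4 (∫ x, f x ∂(empirical u N)) (∫ x, g x ∂(empirical u N)) (∫ x, g x)
    (∫ x, f x)
  linarith

theorem empirical_real_apply {X : Type*} [MeasurableSpace X] (u : ℕ → X) (N : ℕ) {E : Set X}
    (hE : MeasurableSet E) :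
    (empirical u N).real E = (((u ⁻¹' E) ∩ Set.Iio (N + 1)).ncard : ℝ) / ((N + 1 : ℕ) : ℝ) := by
  classical
  have hset : (u ⁻¹' E) ∩ Set.Iio (N + 1) = ((Finset.range (N + 1)).filter fun n => u n ∈ E :) := by
    ext n
    simp [and_comm]
  rw [hset, Set.ncard_coe_finset, Measure.real, empirical, Measure.smul_apply,
    Measure.finsetSum_apply]
  simp only [Measure.dirac_apply' _ hE, Set.indicator_apply, Pi.one_apply, Finset.sum_boole,
    smul_eq_mul]
  rw [ENNReal.toReal_mul, ENNReal.toReal_inv, ENNReal.toReal_add (by finiteness) (by finiteness)]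
  simp [div_eq_inv_mul]

theorem frontier_univ_pi_subset {X : ι → Type*} [∀ i, TopologicalSpace (X i)]
    (A : ∀ i, Set (X i)) :
    frontier (Set.univ.pi A) ⊆ ⋃ i, Function.eval i ⁻¹' frontier (A i) := by
  intro x hx
  rw [frontier, closure_pi_set, interior_pi_set Set.finite_univ] at hx
  obtain ⟨h1, h2⟩ := hx
  simp only [Set.mem_pi, Set.mem_univ, true_imp_iff, not_forall] at h1 h2
  obtain ⟨i, hi⟩ := h2
  exact Set.mem_iUnion.2 ⟨i, h1 i, hi⟩

/-- Weyl's equidistribution theorem for boxes in the torus. -/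
theorem tendsto_ncard_box {θ : ι → ℝ}
    (hθ : ∀ m : ι → ℤ, m ≠ 0 → ∀ z : ℤ, ∑ i, (m i : ℝ) * θ i ≠ z) {A : ι → Set UnitAddCircle}
    (hA : ∀ i, MeasurableSet (A i)) (hfr : ∀ i, volume (frontier (A i)) = 0) :
    Tendsto (fun N : ℕ => (({n : ℕ | ∀ i, ((n * θ i : ℝ) : UnitAddCircle) ∈ A i} ∩
      Set.Iio N).ncard : ℝ) / N) atTop (𝓝 (∏ i, volume.real (A i))) := by
  set u : ℕ → UnitAddTorus ι := fun n i => ((n * θ i : ℝ) : UnitAddCircle) with hu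
  let μ : ProbabilityMeasure (UnitAddTorus ι) := ⟨volume, inferInstance⟩
  let μs : ℕ → ProbabilityMeasure (UnitAddTorus ι) := fun N => ⟨empirical u N, inferInstance⟩
  have hlim : Tendsto μs atTop (𝓝 μ) := by
    rw [ProbabilityMeasure.tendsto_iff_forall_integral_rclike_tendsto ℂ]
    exact fun f => tendsto_empirical_torus hθ f.toContinuousMap
  have hnull : (volume : Measure (UnitAddTorus ι)) (frontier (Set.univ.pi A)) = 0 := by
    refine measure_mono_null (frontier_univ_pi_subset A) (measure_iUnion_null fun i => ?_)
    rw [volume_pi, (measurePreserving_eval (fun _ : ι => (volume : Measure UnitAddCircle)) i).measure_preimage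
      isClosed_frontier.measurableSet.nullMeasurableSet]
    exact hfr i
  have key := ProbabilityMeasure.tendsto_measure_of_null_frontier_of_tendsto' hlim hnull
  have key' := (ENNReal.tendsto_toReal (measure_ne_top _ _)).comp key
  rw [← tendsto_add_atTop_iff_nat 1]
  have hvol : ((volume : Measure (UnitAddTorus ι)) (Set.univ.pi A)).toReal =
      ∏ i, volume.real (A i) := by
    rw [volume_pi_pi, ENNReal.toReal_prod]
    rfl
  rw [← hvol]
  refine key'.congr fun N => ?_
  refine (empirical_real_apply u N (MeasurableSet.univ_pi hA)).trans ?_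
  congr 4
  ext n
  simp [hu]

/-! ### Arcs of the circle -/

/-- The image of the open interval `(a, b)` in the circle `ℝ / ℤ`. -/
def arc (a b : ℝ) : Set UnitAddCircle := ((↑) : ℝ → UnitAddCircle) '' Set.Ioo a b

theorem isOpen_arc (a b : ℝ) : IsOpen (arc a b) :=
  QuotientAddGroup.isOpenMap_coe _ isOpen_Ioo

theorem volume_unitAddCircle_singleton (x : UnitAddCircle) : volume {x} = 0 := by
  rw [← Metric.closedBall_zero, AddCircle.volume_closedBall]
  simp

theorem volume_frontier_arc (a b : ℝ) : volume (frontier (arc a b)) = 0 := by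
  have hsub : frontier (arc a b) ⊆ ((↑) : ℝ → UnitAddCircle) '' {a, b} := by
    intro x hx
    have hcl : closure (arc a b) ⊆ ((↑) : ℝ → UnitAddCircle) '' Set.Icc a b :=
      closure_minimal (Set.image_mono Set.Ioo_subset_Icc_self)
        (isCompact_Icc.image (AddCircle.continuous_mk' 1)).isClosed
    rw [(isOpen_arc a b).frontier_eq] at hx
    obtain ⟨y, hy, rfl⟩ := hcl hx.1
    refine ⟨y, ?_, rfl⟩
    by_contra hne
    simp only [Set.mem_insert_iff, Set.mem_singleton_iff, not_or] at hne
    exact hx.2 ⟨y, ⟨lt_of_le_of_ne hy.1 (Ne.symm hne.1), lt_of_le_of_ne hy.2 hne.2⟩, rfl⟩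
  refine measure_mono_null hsub ?_
  rw [Set.image_pair, Set.insert_eq]
  exact measure_union_null (volume_unitAddCircle_singleton _) (volume_unitAddCircle_singleton _)

theorem volume_real_arc {a b : ℝ} (hab : a ≤ b) (hb : b ≤ a + 1) : volume.real (arc a b) = b - a := by
  have hpre : ((↑) : ℝ → UnitAddCircle) ⁻¹' arc a b ∩ Set.Ioc a (a + 1) = Set.Ioo a b := by
    ext x
    constructor
    · rintro ⟨⟨y, hy, hyx⟩, hx⟩
      rwa [← (AddCircle.coe_eq_coe_iff_of_mem_Ioc (p := (1 : ℝ))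
        ⟨hy.1, hy.2.le.trans hb⟩ hx).1 hyx]
    · exact fun hx => ⟨⟨x, hx, rfl⟩, hx.1, hx.2.le.trans hb⟩
  rw [Measure.real, AddCircle.add_projection_respects_measure (T := 1) a
    (isOpen_arc a b).measurableSet, hpre, Real.volume_Ioo, ENNReal.toReal_ofReal (by linarith)]

theorem coe_mem_arc_iff {a b x : ℝ} :
    (x : UnitAddCircle) ∈ arc a b ↔ ∃ z : ℤ, x - z ∈ Set.Ioo a b := by
  constructor
  · rintro ⟨y, hy, hyx⟩
    rw [eq_comm, ← sub_eq_zero, ← AddCircle.coe_sub, AddCircle.coe_eq_zero_iff] at hyx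
    obtain ⟨z, hz⟩ := hyx
    refine ⟨z, ?_⟩
    rw [zsmul_one] at hz
    rwa [hz, sub_sub_cancel]
  · rintro ⟨z, hz⟩
    refine ⟨x - z, hz, ?_⟩
    simp

/-! ### Multiples in short intervals -/

/-- Some positive multiple of `l` lies strictly between `u` and `v`. -/
def Hits (l u v : ℝ) : Prop := ∃ a : ℕ, 1 ≤ a ∧ (a : ℝ) * l ∈ Set.Ioo u v

theorem pow_mem_Ioo_pow_iff {k : ℕ} (hk : k ≠ 0) {x u v : ℝ} (hx : 0 ≤ x) (hu : 0 ≤ u)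
    (hv : 0 ≤ v) : x ^ k ∈ Set.Ioo (u ^ k) (v ^ k) ↔ x ∈ Set.Ioo u v := by
  simp only [Set.mem_Ioo, pow_lt_pow_iff_left₀ hu hx hk, pow_lt_pow_iff_left₀ hx hv hk]

theorem encard_inter_S_eq_card_iff {k : ℕ} (hk : 2 ≤ k) {I : Finset ℝ} (hI : (I : Set ℝ) ⊆ Lam k)
    (m : ℝ) (hm : 0 ≤ m) :
    (Set.Ioo (m ^ k) ((m + 1) ^ k) ∩ S k (I : Set ℝ)).encard = (I.card : ℕ∞) ↔
      ∀ l ∈ I, Hits l m (m + 1) := by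
  classical
  have hk0 : k ≠ 0 := by omega
  have hl2 : ∀ l ∈ I, 2 < l := fun l hl => two_lt_of_mem_Lam hk (hI hl)
  have hex : ∀ l : ℝ, ∃ a : ℕ, Hits l m (m + 1) → 1 ≤ a ∧ (a : ℝ) * l ∈ Set.Ioo m (m + 1) := by
    intro l
    by_cases h : Hits l m (m + 1)
    · obtain ⟨a, ha⟩ := h
      exact ⟨a, fun _ => ha⟩
    · exact ⟨0, fun h' => absurd h' h⟩
  choose a ha using hex
  have hset : Set.Ioo (m ^ k) ((m + 1) ^ k) ∩ S k (I : Set ℝ) =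
      (fun l => ((a l : ℝ) * l) ^ k) '' (I.filter fun l => Hits l m (m + 1) : Finset ℝ) := by
    ext x
    simp only [Set.mem_inter_iff, Set.mem_image, SetLike.mem_coe, Finset.mem_filter]
    constructor
    · rintro ⟨hx, b, hb, l, hl, rfl⟩
      have hl0 := hl2 l hl
      rw [← mul_pow, pow_mem_Ioo_pow_iff hk0 (by positivity) hm (by positivity)] at hx
      have hh : Hits l m (m + 1) := ⟨b, hb, hx⟩
      refine ⟨l, ⟨hl, hh⟩, ?_⟩
      rw [← mul_pow]
      obtain ⟨-, h1, h2⟩ := ha l hh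
      obtain ⟨h3, h4⟩ := hx
      have hab : a l = b := by
        rcases lt_trichotomy (a l) b with h | h | h
        · have : ((a l : ℝ) + 1) ≤ b := by exact_mod_cast h
          nlinarith
        · exact h
        · have : ((b : ℝ) + 1) ≤ a l := by exact_mod_cast h
          nlinarith
      rw [hab]
    · rintro ⟨l, ⟨hl, hh⟩, rfl⟩
      have hl0 := hl2 l hl
      refine ⟨?_, a l, (ha l hh).1, l, hl, mul_pow _ _ _⟩
      rw [pow_mem_Ioo_pow_iff hk0 (by positivity) hm (by positivity)]
      exact (ha l hh).2
  have hinj : Set.InjOn (fun l => ((a l : ℝ) * l) ^ k)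
      (I.filter fun l => Hits l m (m + 1) : Finset ℝ) := by
    intro l hl l' hl' h
    simp only [SetLike.mem_coe, Finset.mem_filter] at hl hl'
    have hl0 := hl2 l hl.1
    have hl0' := hl2 l' hl'.1
    exact eq_of_mul_eq_mul hk (hI hl.1) (hI hl'.1) (ha l hl.2).1 (ha l' hl'.2).1
      ((pow_left_inj₀ (by positivity) (by positivity) hk0).1 h)
  rw [hset, hinj.encard_image, Set.encard_coe_eq_coe_finsetCard, Nat.cast_inj,
    Finset.card_filter_eq_iff]

theorem Ioo_inter_S_eq_empty_iff {k : ℕ} (hk : 2 ≤ k) {X : Set ℝ} (hX : X ⊆ Lam k)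
    {u v : ℝ} (hu : 0 ≤ u) (hv : 0 ≤ v) :
    Set.Ioo (u ^ k) (v ^ k) ∩ S k X = ∅ ↔ ∀ l ∈ X, ¬ Hits l u v := by
  rw [Set.eq_empty_iff_forall_notMem]
  have hk0 : k ≠ 0 := by omega
  constructor
  · rintro h l hl ⟨a, ha, hal⟩
    have := two_lt_of_mem_Lam hk (hX hl)
    refine h (((a : ℝ) * l) ^ k) ⟨?_, a, ha, l, hl, mul_pow _ _ _⟩
    rwa [pow_mem_Ioo_pow_iff hk0 (by positivity) hu hv]
  · rintro h x ⟨hx, a, ha, l, hl, rfl⟩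
    have := two_lt_of_mem_Lam hk (hX hl)
    rw [← mul_pow, pow_mem_Ioo_pow_iff hk0 (by positivity) hu hv] at hx
    exact h l hl ⟨a, ha, hx⟩

theorem mem_B_iff {k : ℕ} (hk : 2 ≤ k) {I J : Finset ℝ} (hI : (I : Set ℝ) ⊆ Lam k)
    (hJ : (J : Set ℝ) ⊆ Lam k) (n : ℕ) :
    n ∈ B k I J ↔ 1 ≤ n ∧ (∀ l ∈ I, Hits l n (n + 1)) ∧ (∀ l ∈ J, Hits l (n + 1) (n + 2)) ∧
      ∀ l ∈ Lam k \ ((I : Set ℝ) ∪ (J : Set ℝ)), ¬ Hits l n (n + 2) := by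
  have h2 : ((n : ℝ) + 2) = (n + 1) + 1 := by ring
  rw [B, Set.mem_ofPred_eq, encard_inter_S_eq_card_iff hk hI n (by positivity),
    Ioo_inter_S_eq_empty_iff hk Set.sdiff_subset (by positivity) (by positivity), h2,
    encard_inter_S_eq_card_iff hk hJ (n + 1) (by positivity)]

theorem coe_mul_inv_mem_arc_iff {l : ℝ} (hl : 0 < l) (n : ℕ) {s t : ℝ} (hs : 0 ≤ s) :
    ((n * l⁻¹ : ℝ) : UnitAddCircle) ∈ arc (-(t * l⁻¹)) (-(s * l⁻¹)) ↔ Hits l (n + s) (n + t) := by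
  have key : ∀ z : ℝ, n * l⁻¹ - z ∈ Set.Ioo (-(t * l⁻¹)) (-(s * l⁻¹)) ↔
      z * l ∈ Set.Ioo (n + s) (n + t) := by
    intro z
    simp only [Set.mem_Ioo, ← div_eq_mul_inv]
    rw [← div_lt_iff₀ hl, ← lt_div_iff₀ hl, add_div, add_div]
    constructor <;> rintro ⟨h1, h2⟩ <;> constructor <;> linarith
  rw [coe_mem_arc_iff]
  constructor
  · rintro ⟨z, hz⟩
    rw [key] at hz
    have hz0 : 0 < z := by
      have : 0 < (z : ℝ) * l := lt_of_le_of_lt (by positivity) hz.1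
      exact_mod_cast pos_of_mul_pos_left this hl.le
    lift z to ℕ using hz0.le
    exact ⟨z, by omega, by simpa using hz⟩
  · rintro ⟨a, -, ha⟩
    exact ⟨a, by rw [key]; simpa using ha⟩

/-! ### Densities -/

open Classical in
/-- The set of residues of `n / l` modulo `1` prescribed by the conditions at `l`. -/
noncomputable def residueSet (I J : Finset ℝ) (l : ℝ) : Set UnitAddCircle :=
  if l ∈ I then arc (-(1 * l⁻¹)) (-(0 * l⁻¹))
  else if l ∈ J then arc (-(2 * l⁻¹)) (-(1 * l⁻¹))
  else (arc (-(2 * l⁻¹)) (-(0 * l⁻¹)))ᶜ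

/-- The integers satisfying the conditions at all elements of `I`, `J` and `F`. -/
def truncated (I J F : Finset ℝ) : Set ℕ :=
  {n : ℕ | (∀ l ∈ I, Hits l n (n + 1)) ∧ (∀ l ∈ J, Hits l (n + 1) (n + 2)) ∧
    ∀ l ∈ F, ¬ Hits l n (n + 2)}

theorem tendsto_ncard_truncated {k : ℕ} (hk : 2 ≤ k) {I J F : Finset ℝ}
    (hI : (I : Set ℝ) ⊆ Lam k) (hJ : (J : Set ℝ) ⊆ Lam k) (hIJ : Disjoint I J)
    (hF : (F : Set ℝ) ⊆ Lam k \ ((I : Set ℝ) ∪ (J : Set ℝ))) :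
    Tendsto (fun N : ℕ => ((truncated I J F ∩ Set.Iio N).ncard : ℝ) / N) atTop
      (𝓝 ((∏ l ∈ I ∪ J, 1 / l) * ∏ l ∈ F, (1 - 2 / l))) := by
  classical
  have hG : ((I ∪ J ∪ F : Finset ℝ) : Set ℝ) ⊆ Lam k := by
    intro l hl
    simp only [Finset.coe_union, Set.mem_union] at hl
    rcases hl with (hl | hl) | hl
    exacts [hI hl, hJ hl, (hF hl).1]
  have hdisj : Disjoint (I ∪ J) F := by
    rw [Finset.disjoint_left]
    intro l hl hlF
    exact (hF hlF).2 (by simpa using hl)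
  have h2 : ∀ l ∈ I ∪ J ∪ F, 2 < l := fun l hl => two_lt_of_mem_Lam hk (hG hl)
  have hJI : ∀ l ∈ J, l ∉ I := fun l hl hl' => Finset.disjoint_left.1 hIJ hl' hl
  have hFI : ∀ l ∈ F, l ∉ I ∧ l ∉ J := fun l hl => by
    have := (hF hl).2
    simpa [not_or] using this
  have key := tendsto_ncard_box (ι := (I ∪ J ∪ F : Finset ℝ)) (θ := fun l => (l : ℝ)⁻¹)
    (A := fun l => residueSet I J l) (fun m hm z => sum_inv_ne_int hk hG hm z)
    (fun l => by
      unfold residueSet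
      split_ifs
      exacts [(isOpen_arc _ _).measurableSet, (isOpen_arc _ _).measurableSet,
        (isOpen_arc _ _).measurableSet.compl])
    (fun l => by
      unfold residueSet
      split_ifs
      exacts [volume_frontier_arc _ _, volume_frontier_arc _ _,
        by rw [frontier_compl]; exact volume_frontier_arc _ _])
  have hlim : ∏ l : (I ∪ J ∪ F : Finset ℝ), volume.real (residueSet I J l) =
      (∏ l ∈ I ∪ J, 1 / l) * ∏ l ∈ F, (1 - 2 / l) := by
    rw [Finset.prod_coe_sort (I ∪ J ∪ F) fun l => volume.real (residueSet I J l),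
      Finset.prod_union hdisj]
    have hinv : ∀ l ∈ I ∪ J ∪ F, 0 < l⁻¹ ∧ 2 * l⁻¹ ≤ 1 := fun l hl => by
      have := h2 l hl
      refine ⟨by positivity, ?_⟩
      rw [← div_eq_mul_inv, div_le_one (by linarith)]
      exact this.le
    congr 1
    · refine Finset.prod_congr rfl fun l hl => ?_
      obtain ⟨h0, h1⟩ := hinv l (Finset.mem_union_left _ hl)
      unfold residueSet
      split_ifs with hlI hlJ
      · rw [volume_real_arc (by linarith) (by linarith)]
        ring
      · rw [volume_real_arc (by linarith) (by linarith)]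
        ring
      · exact absurd hl (by simp [hlI, hlJ])
    · refine Finset.prod_congr rfl fun l hl => ?_
      obtain ⟨h0, h1⟩ := hinv l (Finset.mem_union_right _ hl)
      rw [residueSet, if_neg (hFI l hl).1, if_neg (hFI l hl).2,
        probReal_compl_eq_one_sub (isOpen_arc _ _).measurableSet,
        volume_real_arc (by linarith) (by linarith)]
      ring
  rw [← hlim]
  have hset : truncated I J F =
      {n : ℕ | ∀ l : (I ∪ J ∪ F : Finset ℝ),
        ((n * (l : ℝ)⁻¹ : ℝ) : UnitAddCircle) ∈ residueSet I J l} := by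
    have hpos : ∀ l ∈ I ∪ J ∪ F, 0 < l := fun l hl => by linarith [h2 l hl]
    have e1 : ∀ (n : ℕ), ∀ l ∈ I, (((n * l⁻¹ : ℝ) : UnitAddCircle) ∈ residueSet I J l ↔
        Hits l n (n + 1)) := fun n l hl => by
      rw [residueSet, if_pos hl, coe_mul_inv_mem_arc_iff (hpos l (by simp [hl])) n le_rfl, add_zero]
    have e2 : ∀ (n : ℕ), ∀ l ∈ J, (((n * l⁻¹ : ℝ) : UnitAddCircle) ∈ residueSet I J l ↔
        Hits l (n + 1) (n + 2)) := fun n l hl => by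
      rw [residueSet, if_neg (hJI l hl), if_pos hl,
        coe_mul_inv_mem_arc_iff (hpos l (by simp [hl])) n zero_le_one]
    have e3 : ∀ (n : ℕ), ∀ l ∈ F, (((n * l⁻¹ : ℝ) : UnitAddCircle) ∈ residueSet I J l ↔
        ¬ Hits l n (n + 2)) := fun n l hl => by
      rw [residueSet, if_neg (hFI l hl).1, if_neg (hFI l hl).2, Set.mem_compl_iff,
        coe_mul_inv_mem_arc_iff (hpos l (by simp [hl])) n le_rfl, add_zero]
    ext n
    simp only [truncated, Set.mem_ofPred_eq, Subtype.forall, Finset.mem_union]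
    constructor
    · rintro ⟨hn1, hn2, hn3⟩ l ((hl | hl) | hl)
      exacts [(e1 n l hl).2 (hn1 l hl), (e2 n l hl).2 (hn2 l hl), (e3 n l hl).2 (hn3 l hl)]
    · intro h
      exact ⟨fun l hl => (e1 n l hl).1 (h l (Or.inl (Or.inl hl))),
        fun l hl => (e2 n l hl).1 (h l (Or.inl (Or.inr hl))),
        fun l hl => (e3 n l hl).1 (h l (Or.inr hl))⟩
  rw [hset]
  exact key

theorem ncard_hits_le {l : ℝ} (hl : 0 < l) (N : ℕ) :
    ({n : ℕ | Hits l n (n + 2)} ∩ Set.Iio N).ncard ≤ 2 * ((N : ℝ) + 1) * l⁻¹ := by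
  classical
  set M := ⌊((N : ℝ) + 1) / l⌋₊ with hM
  have hsub : {n : ℕ | Hits l n (n + 2)} ∩ Set.Iio N ⊆
      ((Finset.Icc 1 M ×ˢ Finset.Icc 1 2).image fun p : ℕ × ℕ => ⌈(p.1 : ℝ) * l⌉₊ - p.2 :) := by
    rintro n ⟨⟨a, ha, h1, h2⟩, hn⟩
    have hn' : (n : ℝ) + 1 ≤ N := by exact_mod_cast hn
    have hc1 : n < ⌈(a : ℝ) * l⌉₊ := Nat.lt_ceil.2 h1
    have hc2 : ⌈(a : ℝ) * l⌉₊ ≤ n + 2 := Nat.ceil_le.2 (by push_cast; exact h2.le)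
    simp only [SetLike.mem_coe, Finset.mem_image, Finset.mem_product, Finset.mem_Icc, Prod.exists]
    refine ⟨a, ⌈(a : ℝ) * l⌉₊ - n, ⟨⟨ha, ?_⟩, by omega, by omega⟩, by omega⟩
    rw [hM, Nat.le_floor_iff (by positivity), le_div_iff₀ hl]
    linarith
  have hcard : ({n : ℕ | Hits l n (n + 2)} ∩ Set.Iio N).ncard ≤ M * 2 := by
    refine (Set.ncard_le_ncard hsub (Finset.finite_toSet _)).trans ?_
    rw [Set.ncard_coe_finset]
    refine Finset.card_image_le.trans ?_
    simp
  have hMle : (M : ℝ) ≤ ((N : ℝ) + 1) / l := Nat.floor_le (by positivity)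
  calc (({n : ℕ | Hits l n (n + 2)} ∩ Set.Iio N).ncard : ℝ) ≤ M * 2 := by exact_mod_cast hcard
    _ ≤ ((N : ℝ) + 1) / l * 2 := by gcongr
    _ = 2 * ((N : ℝ) + 1) * l⁻¹ := by ring

theorem ncard_exists_hits_le {ι : Type*} {f : ι → ℝ} (hf : ∀ i, 0 < f i)
    (hsum : Summable fun i => (f i)⁻¹) (N : ℕ) :
    ({n : ℕ | ∃ i, Hits (f i) n (n + 2)} ∩ Set.Iio N).ncard ≤
      2 * ((N : ℝ) + 1) * ∑' i, (f i)⁻¹ := by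
  classical
  set E := {n : ℕ | ∃ i, Hits (f i) n (n + 2)} ∩ Set.Iio N with hE
  have hfin : E.Finite := (Set.finite_Iio N).subset Set.inter_subset_right
  choose g hg using fun n : E => n.2.1
  have := hfin.fintype
  let L : Finset ι := Finset.univ.image g
  have hsub : E ⊆ ⋃ i ∈ L, ({n : ℕ | Hits (f i) n (n + 2)} ∩ Set.Iio N) := by
    intro n hn
    simp only [Set.mem_iUnion]
    exact ⟨g ⟨n, hn⟩, Finset.mem_image_of_mem _ (Finset.mem_univ _), hg ⟨n, hn⟩, hn.2⟩
  have hle : E.ncard ≤ ∑ i ∈ L, ({n : ℕ | Hits (f i) n (n + 2)} ∩ Set.Iio N).ncard := by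
    refine (Set.ncard_le_ncard hsub ?_).trans (Finset.set_ncard_biUnion_le _ _)
    exact (Set.finite_Iio N).subset (Set.iUnion₂_subset fun i _ => Set.inter_subset_right)
  calc (E.ncard : ℝ) ≤ ∑ i ∈ L, (({n : ℕ | Hits (f i) n (n + 2)} ∩ Set.Iio N).ncard : ℝ) := by
        exact_mod_cast hle
    _ ≤ ∑ i ∈ L, 2 * ((N : ℝ) + 1) * (f i)⁻¹ := Finset.sum_le_sum fun i _ => ncard_hits_le (hf i) N
    _ = 2 * ((N : ℝ) + 1) * ∑ i ∈ L, (f i)⁻¹ := by rw [Finset.mul_sum]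
    _ ≤ 2 * ((N : ℝ) + 1) * ∑' i, (f i)⁻¹ := by
        gcongr
        exact hsum.sum_le_tsum _ fun i _ => (inv_pos.2 (hf i)).le

theorem hasAsymptoticDensity_of_tendsto {A : Set ℕ} {d : ℝ}
    (h : Tendsto (fun N : ℕ => ((A ∩ Set.Iio N).ncard : ℝ) / N) atTop (𝓝 d)) :
    HasAsymptoticDensity A d := by
  have hfl : Tendsto (fun x : ℝ => ⌊x⌋₊ + 1) atTop atTop :=
    (tendsto_add_atTop_nat 1).comp tendsto_nat_floor_atTop
  have hratio : Tendsto (fun x : ℝ => ((⌊x⌋₊ + 1 : ℕ) : ℝ) / x) atTop (𝓝 1) := by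
    have := (tendsto_nat_floor_div_atTop (R := ℝ)).add tendsto_inv_atTop_zero
    rw [add_zero] at this
    refine this.congr fun x => ?_
    push_cast
    ring
  have := (h.comp hfl).mul hratio
  rw [mul_one] at this
  refine this.congr' ?_
  filter_upwards [eventually_gt_atTop 0] with x hx
  have hset : {n : ℕ | n ∈ A ∧ (n : ℝ) ≤ x} = A ∩ Set.Iio (⌊x⌋₊ + 1) := by
    ext n
    simp [Nat.le_floor_iff hx.le]
  rw [hset]
  have : ((⌊x⌋₊ + 1 : ℕ) : ℝ) ≠ 0 := by positivity
  simp only [Function.comp_apply]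
  field_simp

section Limit

variable {k : ℕ} {I J : Finset ℝ}

theorem summable_inv_Lam_diff (hk : 2 ≤ k) :
    Summable fun l : ↥(Lam k \ ((I : Set ℝ) ∪ (J : Set ℝ))) => (l : ℝ)⁻¹ :=
  (summable_inv_Lam hk).comp_injective (Set.inclusion_injective Set.sdiff_subset)

theorem multipliable_one_sub_two_div (hk : 2 ≤ k) :
    Multipliable fun l : ↥(Lam k \ ((I : Set ℝ) ∪ (J : Set ℝ))) => 1 - 2 / (l : ℝ) := by
  have := Real.multipliable_one_add_of_summable
    ((summable_inv_Lam_diff (I := I) (J := J) hk).mul_left (-2))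
  refine this.congr fun l => ?_
  ring

theorem dens_pos (hk : 2 ≤ k) (hI : (I : Set ℝ) ⊆ Lam k) (hJ : (J : Set ℝ) ⊆ Lam k) :
    0 < dens k I J := by
  refine mul_pos (Finset.prod_pos fun l hl => ?_) ?_
  · have : 2 < l := by
      rcases Finset.mem_union.1 hl with hl | hl
      exacts [two_lt_of_mem_Lam hk (hI hl), two_lt_of_mem_Lam hk (hJ hl)]
    positivity
  · have hlog := Real.summable_log_one_add_of_summable
      ((summable_inv_Lam_diff (I := I) (J := J) hk).mul_left (-2))
    rw [← Real.rexp_tsum_eq_tprod]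
    · exact Real.exp_pos _
    · intro l
      have := two_lt_of_mem_Lam hk l.2.1
      rw [sub_pos, div_lt_one (by linarith)]
      exact this
    · refine hlog.congr fun l => ?_
      congr 1
      ring

theorem hasAsymptoticDensity_B (hk : 2 ≤ k) (hI : (I : Set ℝ) ⊆ Lam k) (hJ : (J : Set ℝ) ⊆ Lam k)
    (hIJ : Disjoint I J) : HasAsymptoticDensity (B k I J) (dens k I J) := by
  classical
  refine hasAsymptoticDensity_of_tendsto ?_
  set X := Lam k \ ((I : Set ℝ) ∪ (J : Set ℝ)) with hX
  have hsum : Summable fun l : X => (l : ℝ)⁻¹ := summable_inv_Lam_diff hk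
  have hprod : Tendsto (fun G : Finset X => (∏ l ∈ I ∪ J, 1 / l) * ∏ l ∈ G, (1 - 2 / (l : ℝ))) atTop
      (𝓝 (dens k I J)) :=
    (multipliable_one_sub_two_div (I := I) (J := J) hk).hasProd.const_mul _
  have htail := tendsto_tsum_compl_atTop_zero fun l : X => (l : ℝ)⁻¹
  rw [Metric.tendsto_atTop]
  intro ε hε
  obtain ⟨G, hG1, hG2⟩ := ((Metric.tendsto_nhds.1 hprod (ε / 4) (by positivity)).and
    (Metric.tendsto_nhds.1 htail (ε / 16) (by positivity))).exists
  set F : Finset ℝ := G.map (Function.Embedding.subtype _) with hF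
  have hFX : (F : Set ℝ) ⊆ X := by
    intro l hl
    simp only [hF, Finset.coe_map, Set.mem_image] at hl
    obtain ⟨y, -, rfl⟩ := hl
    exact y.2
  have htr := tendsto_ncard_truncated hk hI hJ hIJ hFX
  rw [hF, Finset.prod_map] at htr
  simp only [Function.Embedding.subtype_apply] at htr
  have hev := (Metric.tendsto_nhds.1 htr (ε / 4) (by positivity)).and
    ((Metric.tendsto_nhds.1 (tendsto_inv_atTop_nhds_zero_nat (𝕜 := ℝ)) (ε / 4) (by positivity)).and
      (eventually_ge_atTop 1))
  obtain ⟨N₀, hN₀⟩ := eventually_atTop.1 hev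
  refine ⟨N₀, fun N hN => ?_⟩
  obtain ⟨h1, h2, h3⟩ := hN₀ N hN
  rw [← hF] at h1
  set T := ∑' l : {l : X // l ∉ G}, ((l : X) : ℝ)⁻¹ with hT
  have hup : ((B k I J ∩ Set.Iio N).ncard : ℝ) ≤ (truncated I J F ∩ Set.Iio N).ncard := by
    have : B k I J ∩ Set.Iio N ⊆ truncated I J F ∩ Set.Iio N := by
      rintro n ⟨hn, hnN⟩
      obtain ⟨-, hn1, hn2, hn3⟩ := (mem_B_iff hk hI hJ n).1 hn
      exact ⟨⟨hn1, hn2, fun l hl => hn3 l (hFX hl)⟩, hnN⟩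
    exact_mod_cast Set.ncard_le_ncard this ((Set.finite_Iio N).subset Set.inter_subset_right)
  have hbad := ncard_exists_hits_le (f := fun l : {l : X // l ∉ G} => ((l : X) : ℝ))
    (fun l => by linarith [two_lt_of_mem_Lam hk l.1.2.1]) (hsum.subtype _) N
  have hlow : ((truncated I J F ∩ Set.Iio N).ncard : ℝ) ≤
      (B k I J ∩ Set.Iio N).ncard + 1 + 2 * ((N : ℝ) + 1) * T := by
    have hsub : truncated I J F ∩ Set.Iio N ⊆ ((B k I J ∩ Set.Iio N) ∪ {0}) ∪
        ({n : ℕ | ∃ l : {l : X // l ∉ G}, Hits ((l : X) : ℝ) n (n + 2)} ∩ Set.Iio N) := by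
      rintro n ⟨⟨hn1, hn2, hn3⟩, hnN⟩
      by_cases hb : ∃ l : {l : X // l ∉ G}, Hits ((l : X) : ℝ) n (n + 2)
      · exact Or.inr ⟨hb, hnN⟩
      · left
        rcases Nat.eq_zero_or_pos n with h0 | h0
        · exact Or.inr h0
        · refine Or.inl ⟨(mem_B_iff hk hI hJ n).2 ⟨h0, hn1, hn2, fun l hl hh => ?_⟩, hnN⟩
          by_cases hlG : (⟨l, hl⟩ : X) ∈ G
          · exact hn3 l (by simpa [hF] using ⟨hl, hlG⟩) hh
          · exact hb ⟨⟨⟨l, hl⟩, hlG⟩, hh⟩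
    have hc := (Set.ncard_le_ncard hsub ((((Set.finite_Iio N).subset Set.inter_subset_right).union
      (Set.finite_singleton 0)).union ((Set.finite_Iio N).subset Set.inter_subset_right))).trans
      ((Set.ncard_union_le _ _).trans (Nat.add_le_add_right (Set.ncard_union_le _ _) _))
    rw [Set.ncard_singleton] at hc
    have hc' : ((truncated I J F ∩ Set.Iio N).ncard : ℝ) ≤ (B k I J ∩ Set.Iio N).ncard + 1 +
        ({n : ℕ | ∃ l : {l : X // l ∉ G}, Hits ((l : X) : ℝ) n (n + 2)} ∩ Set.Iio N).ncard := by
      exact_mod_cast hc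
    linarith
  have hNpos : (1 : ℝ) ≤ N := by exact_mod_cast h3
  have hT0 : 0 ≤ T := tsum_nonneg fun l => by
    have := two_lt_of_mem_Lam hk l.1.2.1
    positivity
  rw [Real.dist_eq, abs_lt] at h1 h2 hG1 hG2 ⊢
  have hup' : ((B k I J ∩ Set.Iio N).ncard : ℝ) / N ≤ (truncated I J F ∩ Set.Iio N).ncard / N := by
    gcongr
  have hlow' : ((truncated I J F ∩ Set.Iio N).ncard : ℝ) / N ≤
      (B k I J ∩ Set.Iio N).ncard / N + (N : ℝ)⁻¹ + 4 * T := by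
    rw [div_le_iff₀ (by linarith)]
    have : ((B k I J ∩ Set.Iio N).ncard / N + (N : ℝ)⁻¹ + 4 * T) * N =
        (B k I J ∩ Set.Iio N).ncard + 1 + 4 * T * N := by
      field_simp
    rw [this]
    nlinarith
  constructor <;> linarith [h1.1, h1.2, h2.1, h2.2, hG1.1, hG1.2, hG2.1, hG2.2]

end Limit

end KFull

theorem mainTheorem1 (k : ℕ) (hk : 2 ≤ k) (I J : Finset ℝ)
    (hI : (I : Set ℝ) ⊆ KFull.Lam k) (hJ : (J : Set ℝ) ⊆ KFull.Lam k) (hIJ : Disjoint I J) :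
    Multipliable
        (fun l : ↥(KFull.Lam k \ ((I : Set ℝ) ∪ (J : Set ℝ))) => 1 - 2 / (l : ℝ)) ∧
      0 < KFull.dens k I J ∧
      KFull.HasAsymptoticDensity (KFull.B k I J) (KFull.dens k I J) :=
  ⟨KFull.multipliable_one_sub_two_div hk, KFull.dens_pos hk hI hJ,
    KFull.hasAsymptoticDensity_B hk hI hJ hIJ⟩
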